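/- Let $\mathcal H$ be a separable complex Hilbert space and let $F(z)=\mathrm{Ln}(1+z)$ on $\mathbb C\setminus(-\infty,-1]$, where $\mathrm{Ln}$ is the principal branch of the logarithm. Let $T_1,T_2$ be self-adjoint, non-negative trace class operators on $\mathcal H$, and put $\Delta T:=T_2-T_1$. Then $F(T_1)$ and $F(T_2)$, defined by the functional calculus, are trace class, and so are $\Delta T$ and $F'(T_1)\Delta T$. The traces $\mathrm{Tr}\,F(T_1)$, $\mathrm{Tr}\,F(T_2)$ and $\mathrm{Tr}\{F'(T_1)\Delta T\}$ are real, and $$|\mathrm{Tr}\,F(T_2)-\mathrm{Tr}\,F(T_1)|\le\|\Delta T\|_1,\qquad \mathrm{Tr}\,F(T_2)\le \mathrm{Tr}\,F(T_1)+\mathrm{Tr}\{F'(T_1)\Delta T\},$$ where $\|A\|_1=\mathrm{Tr}\,|A|$ is the trace norm and $|A|=(A^*A)^{1/2}$. -/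

import Mathlib

open scoped ComplexOrder

noncomputable section

/-- An orthonormal (Hilbert) basis of the Hilbert space `H`, indexed by a set of vectors. -/
def chosenBasis (H : Type*) [NormedAddCommGroup H] [InnerProductSpace ℂ H] [CompleteSpace H] :
    HilbertBasis (exists_hilbertBasis ℂ H).choose ℂ H :=
  (exists_hilbertBasis ℂ H).choose_spec.choose

/-- A bounded operator `T` is trace class if `∑ ⟨e_i, |T| e_i⟩ < ∞`, where `|T| = (T* T)^{1/2}` and
`(e_i)` is an orthonormal basis. All the terms are non-negative, and the sum does not depend on the
basis. -/
def IsTraceClass {H : Type*} [NormedAddCommGroup H] [InnerProductSpace ℂ H] [CompleteSpace H]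
    (T : H →L[ℂ] H) : Prop :=
  Summable fun i => (inner ℂ (chosenBasis H i) (CFC.abs T (chosenBasis H i))).re

/-- The trace norm `‖T‖₁ = Tr |T| = ∑ ⟨e_i, |T| e_i⟩` (meaningful for trace class `T`). -/
def traceNorm {H : Type*} [NormedAddCommGroup H] [InnerProductSpace ℂ H] [CompleteSpace H]
    (T : H →L[ℂ] H) : ℝ :=
  ∑' i, (inner ℂ (chosenBasis H i) (CFC.abs T (chosenBasis H i))).re

/-- The trace `Tr T = ∑ ⟨e_i, T e_i⟩`. For trace class `T` the sum converges absolutely and does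
not depend on the basis. -/
def opTrace {H : Type*} [NormedAddCommGroup H] [InnerProductSpace ℂ H] [CompleteSpace H]
    (T : H →L[ℂ] H) : ℂ :=
  ∑' i, inner ℂ (chosenBasis H i) (T (chosenBasis H i))

/-- `F(z) = Ln(1 + z)`, with the principal branch of the logarithm; it is holomorphic on
`ℂ \ (-∞, -1]`. -/
def lnOneAdd (z : ℂ) : ℂ := Complex.log (1 + z)

end

/-!
Write `F(x) = log (1 + x)`, a concave function on `[0, ∞)` with `F'(x) = (1 + x)⁻¹ ∈ (0, 1]`.
A non-negative trace class operator is compact, so `T₁` has an orthonormal eigenbasis `(eᵢ)` with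
eigenvalues `rᵢ ≥ 0`. Concavity gives, through the functional calculus, the operator inequality
`F(T₂) ≤ F(rᵢ) + F'(rᵢ) (T₂ - rᵢ)`; its diagonal entry at `eᵢ` reads
`⟨eᵢ, F(T₂) eᵢ⟩ ≤ ⟨eᵢ, F(T₁) eᵢ⟩ + ⟨eᵢ, F'(T₁) (T₂ - T₁) eᵢ⟩` (`inner_cfc_lnOneAdd_le`). Summing over
`i` is the trace inequality `opTrace_cfc_lnOneAdd_le`. Its last term is at most `‖T₂ - T₁‖₁`, since
`0 < F' ≤ 1` and `T₂ - T₁ ≤ |T₂ - T₁|`; exchanging `T₁` and `T₂` gives the Lipschitz bound.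

Traces are defined in one fixed basis, so the argument rests on basis independence. With
`S = T^{1/2}` for a trace class `T ≥ 0`, the diagonal terms of `G T` are `⟨S G* e, S e⟩`, and sums of
this kind are basis independent by Parseval's identity and polarization (`hasSum_inner_basis`,
`hasSum_opTrace_mul`). An eigenbasis of the compact operator `T₂ - T₁` shows that it is trace class
(`IsTraceClass.sub`), and operator monotonicity of the square root shows the same for
`F'(T₁) (T₂ - T₁)` (`IsTraceClass.mul_left_of_contraction`).
-/

open ContinuousLinearMap Filter
open scoped ENNReal InnerProductSpace

/-! ### Hilbert–Schmidt operators -/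

section HilbertSchmidt

variable {H : Type*} [NormedAddCommGroup H] [InnerProductSpace ℂ H]
  {ι κ : Type*}

theorem summable_norm_sq_add {A B : H →L[ℂ] H} {b : ι → H}
    (hA : Summable fun i => ‖A (b i)‖ ^ 2) (hB : Summable fun i => ‖B (b i)‖ ^ 2) :
    Summable fun i => ‖(A + B) (b i)‖ ^ 2 := by
  refine Summable.of_nonneg_of_le (fun i => by positivity) (fun i => ?_)
    ((hA.add hB).mul_left 2)
  have h := norm_add_le (A (b i)) (B (b i))
  have h0 := norm_nonneg (A (b i) + B (b i))
  rw [add_apply]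
  nlinarith [sq_nonneg (‖A (b i)‖ - ‖B (b i)‖)]

theorem summable_norm_sq_smul (z : ℂ) {A : H →L[ℂ] H} {b : ι → H}
    (hA : Summable fun i => ‖A (b i)‖ ^ 2) : Summable fun i => ‖(z • A) (b i)‖ ^ 2 := by
  simpa only [smul_apply, norm_smul, mul_pow] using hA.mul_left (‖z‖ ^ 2)

theorem isCompactOperator_smulRight (x y : H) :
    IsCompactOperator ((innerSL ℂ x).smulRight y : H →L[ℂ] H) :=
  (isCompactOperator_of_locallyCompactSpace_rng (toSpanSingleton ℂ y)).comp_clm (innerSL ℂ x)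

/-- Parseval's identity. -/
theorem HilbertBasis.hasSum_norm_inner_sq (b : HilbertBasis ι ℂ H) (x : H) :
    HasSum (fun i => ‖inner ℂ (b i) x‖ ^ 2) (‖x‖ ^ 2) := by
  have h := b.hasSum_inner_mul_inner x x
  rw [inner_self_eq_norm_sq_to_K] at h
  have h2 : ∀ i, inner ℂ x (b i) * inner ℂ (b i) x = ((‖inner ℂ (b i) x‖ ^ 2 : ℝ) : ℂ) := by
    intro i
    rw [← inner_conj_symm x (b i), Complex.conj_mul']
    push_cast; rfl
  simp only [h2] at h
  exact Complex.hasSum_ofReal.mp (by simpa using h)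

theorem HilbertBasis.tsum_ofReal_norm_inner_sq (b : HilbertBasis ι ℂ H) (x : H) :
    ∑' i, ENNReal.ofReal (‖inner ℂ (b i) x‖ ^ 2) = ENNReal.ofReal (‖x‖ ^ 2) := by
  rw [← (b.hasSum_norm_inner_sq x).tsum_eq,
    ENNReal.ofReal_tsum_of_nonneg (fun i => by positivity) (b.hasSum_norm_inner_sq x).summable]

variable [CompleteSpace H]

/-- Both sides are the double sum `∑ |⟨c j, A (b i)⟩|²`. It is taken in `ℝ≥0∞`, where the order of
summation may be exchanged without a convergence hypothesis. -/
theorem tsum_ofReal_norm_sq_eq_adjoint (A : H →L[ℂ] H) (b : HilbertBasis ι ℂ H)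
    (c : HilbertBasis κ ℂ H) :
    ∑' i, ENNReal.ofReal (‖A (b i)‖ ^ 2) = ∑' j, ENNReal.ofReal (‖adjoint A (c j)‖ ^ 2) := by
  rw [tsum_congr fun i => (c.tsum_ofReal_norm_inner_sq (A (b i))).symm, ENNReal.tsum_comm]
  refine tsum_congr fun j => ?_
  rw [← b.tsum_ofReal_norm_inner_sq]
  refine tsum_congr fun i => ?_
  rw [← adjoint_inner_left, norm_inner_symm]

/-- The square of the Hilbert–Schmidt norm does not depend on the basis: both sides equal the value
of the adjoint in the basis `b`. -/
theorem tsum_ofReal_norm_sq_eq (A : H →L[ℂ] H) (b : HilbertBasis ι ℂ H)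
    (c : HilbertBasis κ ℂ H) :
    ∑' i, ENNReal.ofReal (‖A (b i)‖ ^ 2) = ∑' j, ENNReal.ofReal (‖A (c j)‖ ^ 2) := by
  rw [tsum_ofReal_norm_sq_eq_adjoint A b b, tsum_ofReal_norm_sq_eq_adjoint A c b]

theorem summable_iff_tsum_ofReal_ne_top {f : ι → ℝ} (hf : ∀ i, 0 ≤ f i) :
    Summable f ↔ ∑' i, ENNReal.ofReal (f i) ≠ ∞ := by
  refine ⟨fun h => h.tsum_ofReal_ne_top, fun h => ?_⟩
  have := ENNReal.summable_toReal h
  simpa only [ENNReal.toReal_ofReal (hf _)] using this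

theorem tsum_eq_toReal_tsum_ofReal {f : ι → ℝ} (hf : ∀ i, 0 ≤ f i) :
    ∑' i, f i = (∑' i, ENNReal.ofReal (f i)).toReal := by
  rw [ENNReal.tsum_toReal_eq (fun i => ENNReal.ofReal_ne_top)]
  simp only [ENNReal.toReal_ofReal (hf _)]

theorem summable_norm_sq_basis_iff (A : H →L[ℂ] H) (b : HilbertBasis ι ℂ H)
    (c : HilbertBasis κ ℂ H) :
    Summable (fun i => ‖A (b i)‖ ^ 2) ↔ Summable (fun j => ‖A (c j)‖ ^ 2) := by
  rw [summable_iff_tsum_ofReal_ne_top (fun i => by positivity),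
    summable_iff_tsum_ofReal_ne_top (fun i => by positivity), tsum_ofReal_norm_sq_eq A b c]

theorem summable_norm_sq_adjoint_iff (A : H →L[ℂ] H) (b : HilbertBasis ι ℂ H)
    (c : HilbertBasis κ ℂ H) :
    Summable (fun i => ‖A (b i)‖ ^ 2) ↔ Summable (fun j => ‖adjoint A (c j)‖ ^ 2) := by
  rw [summable_iff_tsum_ofReal_ne_top (fun i => by positivity),
    summable_iff_tsum_ofReal_ne_top (fun i => by positivity), tsum_ofReal_norm_sq_eq_adjoint A b c]

theorem tsum_norm_sq_basis_eq (A : H →L[ℂ] H) (b : HilbertBasis ι ℂ H)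
    (c : HilbertBasis κ ℂ H) :
    ∑' i, ‖A (b i)‖ ^ 2 = ∑' j, ‖A (c j)‖ ^ 2 := by
  rw [tsum_eq_toReal_tsum_ofReal (fun i => by positivity),
    tsum_eq_toReal_tsum_ofReal (fun i => by positivity), tsum_ofReal_norm_sq_eq A b c]

/-- The sum `∑ ⟨A eᵢ, B eᵢ⟩` for Hilbert–Schmidt `A` and `B` converges to the same value in all
orthonormal bases, because by polarization it is a combination of four squared Hilbert–Schmidt
norms. -/
theorem hasSum_inner_basis {A B : H →L[ℂ] H} (b : HilbertBasis ι ℂ H)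
    (c : HilbertBasis κ ℂ H)
    (hA : Summable fun i => ‖A (b i)‖ ^ 2) (hB : Summable fun i => ‖B (b i)‖ ^ 2) :
    ∃ s, HasSum (fun i => inner ℂ (A (b i)) (B (b i))) s ∧
      HasSum (fun j => inner ℂ (A (c j)) (B (c j))) s := by
  have key : ∀ z : ℂ, ∃ t : ℂ, HasSum (fun i => ((‖(A + z • B) (b i)‖ : ℂ) ^ 2)) t ∧
      HasSum (fun j => ((‖(A + z • B) (c j)‖ : ℂ) ^ 2)) t := by
    intro z
    have h := summable_norm_sq_add hA (summable_norm_sq_smul z hB)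
    refine ⟨((∑' i, ‖(A + z • B) (b i)‖ ^ 2 : ℝ) : ℂ), ?_, ?_⟩
    · exact_mod_cast Complex.hasSum_ofReal.mpr h.hasSum
    · rw [tsum_norm_sq_basis_eq _ b c]
      exact_mod_cast Complex.hasSum_ofReal.mpr ((summable_norm_sq_basis_iff _ b c).mp h).hasSum
  obtain ⟨t₁, h₁, h₁'⟩ := key 1
  obtain ⟨t₂, h₂, h₂'⟩ := key (-1)
  obtain ⟨t₃, h₃, h₃'⟩ := key (-Complex.I)
  obtain ⟨t₄, h₄, h₄'⟩ := key Complex.I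
  have pol : ∀ x : H, inner ℂ (A x) (B x) =
      ((‖(A + (1 : ℂ) • B) x‖ : ℂ) ^ 2 - (‖(A + (-1 : ℂ) • B) x‖ : ℂ) ^ 2
        + ((‖(A + (-Complex.I) • B) x‖ : ℂ) ^ 2
        - (‖(A + Complex.I • B) x‖ : ℂ) ^ 2) * Complex.I) / 4 := by
    intro x
    rw [inner_eq_sum_norm_sq_div_four]
    simp [sub_eq_add_neg]
  refine ⟨(t₁ - t₂ + (t₃ - t₄) * Complex.I) / 4, ?_, ?_⟩
  · simp only [pol]
    exact ((h₁.sub h₂).add ((h₃.sub h₄).mul_right _)).div_const _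
  · simp only [pol]
    exact ((h₁'.sub h₂').add ((h₃'.sub h₄').mul_right _)).div_const _

/-- The operator norm is at most the Hilbert–Schmidt norm. -/
theorem norm_sq_le_tsum_norm_sq (A : H →L[ℂ] H) (b : HilbertBasis ι ℂ H)
    (hA : Summable fun i => ‖A (b i)‖ ^ 2) : ‖A‖ ^ 2 ≤ ∑' i, ‖A (b i)‖ ^ 2 := by
  have h0 : 0 ≤ ∑' i, ‖A (b i)‖ ^ 2 := tsum_nonneg fun i => by positivity
  -- The adjoint is estimated instead, since `⟨b i, A† y⟩ = ⟨A (b i), y⟩` makes Parseval applicable.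
  rw [← Real.le_sqrt (norm_nonneg _) h0, ← LinearIsometryEquiv.norm_map adjoint A]
  refine opNorm_le_bound _ (Real.sqrt_nonneg _) fun y => ?_
  refine abs_le_of_sq_le_sq' ?_ (by positivity) |>.2
  rw [mul_pow, Real.sq_sqrt h0, ← (b.hasSum_norm_inner_sq (adjoint A y)).tsum_eq, ← tsum_mul_right]
  refine (b.hasSum_norm_inner_sq _).summable.tsum_le_tsum (fun i => ?_) (hA.mul_right _)
  rw [adjoint_inner_right, ← mul_pow]
  gcongr
  exact norm_inner_le_norm _ _

/-- A Hilbert–Schmidt operator is the norm limit of its truncations to finitely many basis vectors,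
hence compact. -/
theorem isCompactOperator_of_summable_norm_sq (A : H →L[ℂ] H) (b : HilbertBasis ι ℂ H)
    (hA : Summable fun i => ‖A (b i)‖ ^ 2) : IsCompactOperator A := by
  classical
  let P : Finset ι → H →L[ℂ] H := fun s => ∑ i ∈ s, (innerSL ℂ (b i)).smulRight (A (b i))
  have hP : ∀ s, IsCompactOperator (P s) := fun s =>
    Submodule.sum_mem (compactOperator (RingHom.id ℂ) H H) (t := s)
      fun i _ => isCompactOperator_smulRight (b i) (A (b i))
  have hPb : ∀ s j, P s (b j) = if j ∈ s then A (b j) else 0 := by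
    intro s j
    simp [P, sum_apply, orthonormal_iff_ite.mp b.orthonormal, ite_smul]
  refine isCompactOperator_of_tendsto (l := atTop) (F := P) ?_ (Eventually.of_forall hP)
  rw [tendsto_iff_norm_sub_tendsto_zero]
  have hterm : ∀ s j, ‖(P s - A) (b j)‖ ^ 2 = if j ∈ s then 0 else ‖A (b j)‖ ^ 2 := by
    intro s j
    rw [sub_apply, hPb]
    split_ifs <;> simp
  have hsum : ∀ s, HasSum (fun j => ‖(P s - A) (b j)‖ ^ 2)
      (∑' i, ‖A (b i)‖ ^ 2 - ∑ i ∈ s, ‖A (b i)‖ ^ 2) := by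
    intro s
    have h := hA.hasSum.sub (hasSum_sum_of_ne_finset_zero
      (f := fun j => if j ∈ s then ‖A (b j)‖ ^ 2 else 0) (s := s) (fun j hj => by simp [hj]))
    rw [Finset.sum_congr rfl (fun j hj => if_pos hj)] at h
    refine h.congr_fun fun j => ?_
    rw [hterm]
    split_ifs <;> simp
  have hlim : Tendsto (fun s : Finset ι => ∑' i, ‖A (b i)‖ ^ 2 - ∑ i ∈ s, ‖A (b i)‖ ^ 2)
      atTop (nhds 0) := by
    have h : Tendsto (fun s : Finset ι => ∑ i ∈ s, ‖A (b i)‖ ^ 2) atTop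
        (nhds (∑' i, ‖A (b i)‖ ^ 2)) := hA.hasSum
    rw [← sub_self (∑' i, ‖A (b i)‖ ^ 2)]
    exact h.const_sub _
  have hsq : Tendsto (fun s => ‖P s - A‖ ^ 2) atTop (nhds 0) :=
    squeeze_zero (fun s => by positivity)
      (fun s => (norm_sq_le_tsum_norm_sq _ b (hsum s).summable).trans_eq (hsum s).tsum_eq) hlim
  simpa using hsq.sqrt

end HilbertSchmidt

/-! ### Eigenvectors and eigenbases -/

section Eigenvectors

variable {H : Type*} [NormedAddCommGroup H] [InnerProductSpace ℂ H]

theorem mem_spectrum_of_eigenvector {T : H →L[ℂ] H} {r : ℝ} {v : H}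
    (hv : T v = (r : ℂ) • v) (hv0 : v ≠ 0) : r ∈ spectrum ℝ T := by
  intro hu
  obtain ⟨u, hu⟩ := hu
  have h : (algebraMap ℝ (H →L[ℂ] H) r - T) v = 0 := by
    simp [Algebra.algebraMap_eq_smul_one, hv]
  rw [← hu] at h
  apply hv0
  calc v = ((↑u⁻¹ : H →L[ℂ] H) * (u : H →L[ℂ] H)) v := by simp
    _ = 0 := by rw [mul_apply_eq_comp, h, map_zero]

/-- A vector orthogonal to a Hilbert basis of a subspace is orthogonal to the subspace. -/
theorem HilbertBasis.mem_orthogonal_of_forall_inner_eq_zero {ι : Type*} {K : Submodule ℂ H}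
    (e : HilbertBasis ι ℂ K) {x : H} (hx : ∀ i, inner ℂ (e i : H) x = 0) : x ∈ Kᗮ := by
  rw [Submodule.mem_orthogonal']
  intro u hu
  have h := ((innerSL ℂ x).comp (Submodule.subtypeL K)).hasSum (e.hasSum_repr ⟨u, hu⟩)
  refine h.unique ?_
  have h0 : ∀ i, ((innerSL ℂ x).comp (Submodule.subtypeL K)) (e.repr ⟨u, hu⟩ i • e i) = 0 := by
    intro i
    rw [map_smul]
    simp only [comp_apply, Submodule.subtypeL_apply, innerSL_apply_apply]
    rw [inner_eq_zero_symm.mp (hx i), smul_zero]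
  simpa only [Function.comp_def, h0] using hasSum_zero

variable [CompleteSpace H]

/-- The functional calculus acts on an eigenvector for the eigenvalue `r` as multiplication by `f r`:
the functions with this property form a closed subalgebra containing the identity. -/
theorem cfc_apply_eigenvector {T : H →L[ℂ] H} (hT : IsSelfAdjoint T) {r : ℝ} {v : H}
    (hv : T v = (r : ℂ) • v) {f : ℝ → ℝ} (hf : ContinuousOn f (spectrum ℝ T)) :
    cfc f T v = (f r : ℂ) • v := by
  rcases eq_or_ne v 0 with rfl | hv0
  · simp
  have hr := mem_spectrum_of_eigenvector hv hv0
  rw [cfc_apply f T]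
  suffices h : ∀ g : C(spectrum ℝ T, ℝ), cfcHom hT g v = (g ⟨r, hr⟩ : ℂ) • v from h _
  have hid : cfcHom hT (ContinuousMap.restrict (spectrum ℝ T) (ContinuousMap.id ℝ)) = T :=
    cfcHom_id hT
  intro g
  induction g using ContinuousMap.induction_on_of_compact with
  | const s =>
    have : ContinuousMap.const (spectrum ℝ T) s = algebraMap ℝ _ s := rfl
    rw [this, AlgHomClass.commutes]
    simp [Algebra.algebraMap_eq_smul_one]
  | id => rw [hid, hv]; rfl
  | star_id => rw [map_star, hid, hT.star_eq, hv]; simp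
  | add g₁ g₂ h₁ h₂ => simp [h₁, h₂, add_smul]
  | mul g₁ g₂ h₁ h₂ => simp [h₁, h₂, mul_smul, smul_comm (g₁ _ : ℂ)]
  | frequently g hg =>
    have hcl : IsClosed {g : C(spectrum ℝ T, ℝ) | cfcHom hT g v = (g ⟨r, hr⟩ : ℂ) • v} := by
      refine isClosed_eq ?_ ?_
      · exact (ContinuousLinearMap.apply ℂ H v).continuous.comp (cfcHom_continuous hT)
      · exact (Complex.continuous_ofReal.comp (continuous_eval_const _)).smul
          continuous_const
    exact hcl.closure_subset (mem_closure_iff_frequently.mpr hg)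

/-- The union of orthonormal bases of the eigenspaces of a compact self-adjoint operator is an
orthonormal basis of the whole space. -/
theorem exists_hilbertBasis_eigenvectors.{u} {H : Type u} [NormedAddCommGroup H]
    [InnerProductSpace ℂ H] [CompleteSpace H] {T : H →L[ℂ] H} (hT : IsSelfAdjoint T)
    (hc : IsCompactOperator T) :
    ∃ (ι : Type u) (b : HilbertBasis ι ℂ H) (μ : ι → ℝ), ∀ i, T (b i) = (μ i : ℂ) • b i := by
  have hsymm : (T : H →ₗ[ℂ] H).IsSymmetric := isSelfAdjoint_iff_isSymmetric.mp hT
  have hcomplete : ∀ z, CompleteSpace (Module.End.eigenspace (T : H →ₗ[ℂ] H) z) := fun z => by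
    have h : (Module.End.eigenspace (T : H →ₗ[ℂ] H) z : Set H) = {x | T x = z • x} := by
      ext x; simp
    have hclosed : IsClosed (Module.End.eigenspace (T : H →ₗ[ℂ] H) z : Set H) := by
      rw [h]
      exact isClosed_eq T.continuous (continuous_const_smul z)
    exact hclosed.completeSpace_coe
  obtain ⟨w, e, -⟩ : ∃ (w : ∀ z, Set (Module.End.eigenspace (T : H →ₗ[ℂ] H) z))
      (e : ∀ z, HilbertBasis (w z) ℂ (Module.End.eigenspace (T : H →ₗ[ℂ] H) z)), True :=
    ⟨_, fun z => chosenBasis _, trivial⟩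
  let v : (Σ z, w z) → H := fun a => (e a.1 a.2 : Module.End.eigenspace (T : H →ₗ[ℂ] H) a.1)
  have hon : Orthonormal ℂ v :=
    hsymm.orthogonalFamily_eigenspaces.orthonormal_sigma_orthonormal (fun z => (e z).orthonormal)
  have hbot : (Submodule.span ℂ (Set.range v))ᗮ = ⊥ := by
    rw [eq_bot_iff, ← ContinuousLinearMap.orthogonalComplement_iSup_eigenspaces_eq_bot hc hsymm,
      ← Submodule.iInf_orthogonal]
    intro x hx
    rw [Submodule.mem_iInf]
    intro z
    rw [Submodule.mem_orthogonal] at hx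
    exact (e z).mem_orthogonal_of_forall_inner_eq_zero
      fun i => hx _ (Submodule.subset_span ⟨⟨z, i⟩, rfl⟩)
  have heig : ∀ a : Σ z, w z, T (v a) = a.1 • v a := fun a =>
    Module.End.mem_eigenspace_iff.mp (e a.1 a.2).2
  have hre : ∀ a : Σ z, w z, ((a.1.re : ℝ) : ℂ) = a.1 := fun a =>
    Complex.conj_eq_iff_re.mp (hsymm.conj_eigenvalue_eq_self
      (Module.End.hasEigenvalue_of_hasEigenvector ⟨(e a.1 a.2).2, hon.ne_zero a⟩))
  refine ⟨Σ z, w z, HilbertBasis.mkOfOrthogonalEqBot hon hbot, fun a => a.1.re, fun a => ?_⟩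
  rw [HilbertBasis.coe_mkOfOrthogonalEqBot, hre]
  exact heig a

end Eigenvectors

/-! ### Trace class operators and basis independence of the trace -/

section TraceClass

variable {H : Type*} [NormedAddCommGroup H] [InnerProductSpace ℂ H]
  {ι κ : Type*}

theorem inner_apply_nonneg {T : H →L[ℂ] H} (hT : 0 ≤ T) (x : H) : 0 ≤ inner ℂ x (T x) :=
  ((nonneg_iff_isPositive T).mp hT).inner_nonneg_right x

theorem re_inner_apply_nonneg {T : H →L[ℂ] H} (hT : 0 ≤ T) (x : H) : 0 ≤ (inner ℂ x (T x)).re :=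
  (Complex.le_def.mp (inner_apply_nonneg hT x)).1

theorem inner_apply_mono {S T : H →L[ℂ] H} (h : S ≤ T) (x : H) :
    inner ℂ x (S x) ≤ inner ℂ x (T x) := by
  have := ((ContinuousLinearMap.le_def S T).mp h).inner_nonneg_right x
  rwa [sub_apply, inner_sub_right, sub_nonneg] at this

theorem coe_re_inner_apply {T : H →L[ℂ] H} (hT : 0 ≤ T) (x : H) :
    ((inner ℂ x (T x)).re : ℂ) = inner ℂ x (T x) :=
  (Complex.eq_re_of_ofReal_le (r := 0) (by simpa using inner_apply_nonneg hT x)).symm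

theorem inner_ofReal_smul_self (r : ℝ) (v : H) :
    inner ℂ v ((r : ℂ) • v) = ((r * ‖v‖ ^ 2 : ℝ) : ℂ) := by
  rw [inner_smul_right, inner_self_eq_norm_sq_to_K]
  push_cast
  rfl

variable [CompleteSpace H]

theorem inner_apply_eq_inner_sqrt {T : H →L[ℂ] H} (hT : 0 ≤ T) (x y : H) :
    inner ℂ x (T y) = inner ℂ (CFC.sqrt T x) (CFC.sqrt T y) := by
  have h : adjoint (CFC.sqrt T) = CFC.sqrt T :=
    (IsSelfAdjoint.of_nonneg (CFC.sqrt_nonneg T)).star_eq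
  nth_rw 1 [← CFC.sqrt_mul_sqrt_self T hT]
  rw [mul_apply_eq_comp, ← adjoint_inner_left, h]

theorem re_inner_apply_eq_norm_sqrt_sq {T : H →L[ℂ] H} (hT : 0 ≤ T) (x : H) :
    (inner ℂ x (T x)).re = ‖CFC.sqrt T x‖ ^ 2 := by
  rw [inner_apply_eq_inner_sqrt hT, inner_self_eq_norm_sq_to_K]
  norm_cast

/-- `T` is trace class exactly when `|T|^{1/2}` is Hilbert–Schmidt, a condition that may be tested in
any orthonormal basis. -/
theorem isTraceClass_iff_summable_norm_sqrt_sq (T : H →L[ℂ] H) (b : HilbertBasis ι ℂ H) :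
    IsTraceClass T ↔ Summable fun i => ‖CFC.sqrt (CFC.abs T) (b i)‖ ^ 2 := by
  rw [← summable_norm_sq_basis_iff _ (chosenBasis H) b]
  simp only [← re_inner_apply_eq_norm_sqrt_sq (CFC.abs_nonneg T)]
  rfl

theorem isTraceClass_iff_of_nonneg {T : H →L[ℂ] H} (hT : 0 ≤ T) (b : HilbertBasis ι ℂ H) :
    IsTraceClass T ↔ Summable fun i => ‖CFC.sqrt T (b i)‖ ^ 2 := by
  rw [isTraceClass_iff_summable_norm_sqrt_sq T b, CFC.abs_of_nonneg T hT]

theorem isTraceClass_iff_summable_abs (T : H →L[ℂ] H) (b : HilbertBasis ι ℂ H) :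
    IsTraceClass T ↔ Summable fun i => (inner ℂ (b i) (CFC.abs T (b i))).re := by
  simp only [isTraceClass_iff_summable_norm_sqrt_sq T b,
    re_inner_apply_eq_norm_sqrt_sq (CFC.abs_nonneg T)]

theorem IsTraceClass.of_abs_le {S T : H →L[ℂ] H} (hT : IsTraceClass T)
    (h : CFC.abs S ≤ CFC.abs T) : IsTraceClass S :=
  Summable.of_nonneg_of_le
    (fun _ => re_inner_apply_nonneg (CFC.abs_nonneg S) _)
    (fun _ => (Complex.le_def.mp (inner_apply_mono h _)).1) hT

theorem IsTraceClass.of_nonneg_of_le {S T : H →L[ℂ] H} (hT : IsTraceClass T) (hS : 0 ≤ S)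
    (h : S ≤ T) : IsTraceClass S :=
  hT.of_abs_le (by rwa [CFC.abs_of_nonneg S hS, CFC.abs_of_nonneg T (hS.trans h)])

theorem IsTraceClass.abs {T : H →L[ℂ] H} (hT : IsTraceClass T) : IsTraceClass (CFC.abs T) :=
  hT.of_abs_le (CFC.cfcAbs_cfcAbs T).le

/-- If `G* G ≤ 1` then `|G T|² = T* G* G T ≤ T* T`, and the square root is operator monotone, so
`|G T| ≤ |T|`. -/
theorem IsTraceClass.mul_left_of_contraction {G T : H →L[ℂ] H} (hT : IsTraceClass T)
    (hG : star G * G ≤ 1) : IsTraceClass (G * T) := by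
  refine hT.of_abs_le (CFC.sqrt_le_sqrt _ _ ?_)
  have h := star_left_conjugate_le_conjugate hG T
  simpa [mul_assoc] using h

/-- For trace class `T ≥ 0` and bounded `G`, the trace of `G T` may be computed in any orthonormal
basis: `⟨e, G T e⟩ = ⟨T^{1/2} G* e, T^{1/2} e⟩` pairs two Hilbert–Schmidt operators. -/
theorem hasSum_opTrace_mul {T : H →L[ℂ] H} (hT : 0 ≤ T) (htc : IsTraceClass T) (G : H →L[ℂ] H)
    (b : HilbertBasis ι ℂ H) :
    HasSum (fun i => inner ℂ (b i) ((G * T) (b i))) (opTrace (G * T)) := by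
  have hS := (isTraceClass_iff_of_nonneg hT (chosenBasis H)).mp htc
  have hsa : adjoint (CFC.sqrt T) = CFC.sqrt T :=
    (IsSelfAdjoint.of_nonneg (CFC.sqrt_nonneg T)).star_eq
  have hSG : Summable fun i => ‖(CFC.sqrt T * adjoint G) (chosenBasis H i)‖ ^ 2 := by
    rw [summable_norm_sq_adjoint_iff _ _ (chosenBasis H)]
    refine Summable.of_nonneg_of_le (fun i => by positivity) (fun i => ?_) (hS.mul_left (‖G‖ ^ 2))
    rw [← star_eq_adjoint, star_mul, star_eq_adjoint, star_eq_adjoint, adjoint_adjoint, hsa,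
      mul_apply_eq_comp, ← mul_pow]
    gcongr
    exact le_opNorm _ _
  obtain ⟨s, h₁, h₂⟩ := hasSum_inner_basis (chosenBasis H) b hSG hS
  have h : ∀ x : H, inner ℂ ((CFC.sqrt T * adjoint G) x) (CFC.sqrt T x)
      = inner ℂ x ((G * T) x) := by
    intro x
    rw [mul_apply_eq_comp, mul_apply_eq_comp, ← inner_apply_eq_inner_sqrt hT, adjoint_inner_left]
  simp only [h] at h₁ h₂
  rwa [opTrace, h₁.tsum_eq]

theorem hasSum_opTrace {T : H →L[ℂ] H} (hT : 0 ≤ T) (htc : IsTraceClass T)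
    (b : HilbertBasis ι ℂ H) :
    HasSum (fun i => inner ℂ (b i) (T (b i))) (opTrace T) := by
  simpa only [one_mul] using hasSum_opTrace_mul hT htc 1 b

theorem hasSum_opTrace_mul_sub {S T : H →L[ℂ] H} (hS : 0 ≤ S) (hT : 0 ≤ T) (hSc : IsTraceClass S)
    (hTc : IsTraceClass T) (G : H →L[ℂ] H) (b : HilbertBasis ι ℂ H) :
    HasSum (fun i => inner ℂ (b i) ((G * (T - S)) (b i))) (opTrace (G * (T - S))) := by
  have h : ∀ x : H, inner ℂ x ((G * (T - S)) x)
      = inner ℂ x ((G * T) x) - inner ℂ x ((G * S) x) := by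
    intro x
    rw [mul_sub, sub_apply, inner_sub_right]
  have hc := (hasSum_opTrace_mul hT hTc G (chosenBasis H)).sub
    (hasSum_opTrace_mul hS hSc G (chosenBasis H))
  have hb := (hasSum_opTrace_mul hT hTc G b).sub (hasSum_opTrace_mul hS hSc G b)
  simp only [← h] at hb hc
  rwa [opTrace, hc.tsum_eq]

theorem hasSum_traceNorm {T : H →L[ℂ] H} (hT : IsTraceClass T) (b : HilbertBasis ι ℂ H) :
    HasSum (fun i => inner ℂ (b i) (CFC.abs T (b i))) (traceNorm T : ℂ) := by
  have h := hasSum_opTrace (CFC.abs_nonneg T) hT.abs b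
  convert h using 1
  rw [opTrace, traceNorm, Complex.ofReal_tsum]
  simp only [coe_re_inner_apply (CFC.abs_nonneg T)]

/-- A trace class `T ≥ 0` is the square of the Hilbert–Schmidt, hence compact, operator `T^{1/2}`. -/
theorem IsTraceClass.isCompactOperator {T : H →L[ℂ] H} (hT : 0 ≤ T) (htc : IsTraceClass T) :
    IsCompactOperator T := by
  have h := isCompactOperator_of_summable_norm_sq _ _
    ((isTraceClass_iff_of_nonneg hT (chosenBasis H)).mp htc)
  have h2 := h.comp_clm (CFC.sqrt T)
  rw [← CFC.sqrt_mul_sqrt_self T hT]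
  exact h2

theorem re_inner_abs_eigenvector {A : H →L[ℂ] H} (hA : IsSelfAdjoint A) {r : ℝ} {v : H}
    (hv : A v = (r : ℂ) • v) :
    (inner ℂ v (CFC.abs A v)).re = |(inner ℂ v (A v)).re| := by
  rw [CFC.abs_eq_cfc_norm A hA, cfc_apply_eigenvector hA hv (by fun_prop), hv,
    inner_ofReal_smul_self, inner_ofReal_smul_self, Complex.ofReal_re, Complex.ofReal_re, abs_mul,
    Real.norm_eq_abs, abs_of_nonneg (sq_nonneg ‖v‖)]

/-- There is no operator inequality `|T - S| ≤ T + S`, but in an eigenbasis `(eᵢ)` of the compact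
operator `T - S` the diagonal terms satisfy `⟨eᵢ, |T - S| eᵢ⟩ = |⟨eᵢ, (T - S) eᵢ⟩| ≤ ⟨eᵢ, (T + S) eᵢ⟩`. -/
theorem IsTraceClass.sub {S T : H →L[ℂ] H} (hS : 0 ≤ S) (hT : 0 ≤ T) (hSc : IsTraceClass S)
    (hTc : IsTraceClass T) : IsTraceClass (T - S) := by
  have hsa : IsSelfAdjoint (T - S) := (IsSelfAdjoint.of_nonneg hT).sub (IsSelfAdjoint.of_nonneg hS)
  have hcomp : IsCompactOperator (T - S) :=
    Submodule.sub_mem (compactOperator (RingHom.id ℂ) H H) (hTc.isCompactOperator hT)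
      (hSc.isCompactOperator hS)
  obtain ⟨ι, b, r, hb⟩ := exists_hilbertBasis_eigenvectors hsa hcomp
  rw [isTraceClass_iff_summable_abs _ b]
  have h1 := (isTraceClass_iff_summable_abs S b).mp hSc
  have h2 := (isTraceClass_iff_summable_abs T b).mp hTc
  rw [CFC.abs_of_nonneg S hS] at h1
  rw [CFC.abs_of_nonneg T hT] at h2
  refine Summable.of_nonneg_of_le
    (fun i => re_inner_apply_nonneg (CFC.abs_nonneg (T - S)) (b i))
    (fun i => ?_) (h2.add h1)
  have p1 := re_inner_apply_nonneg hS (b i)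
  have p2 := re_inner_apply_nonneg hT (b i)
  rw [re_inner_abs_eigenvector hsa (hb i), sub_apply, inner_sub_right, Complex.sub_re, abs_le]
  constructor <;> linarith

end TraceClass

/-! ### Trace inequalities for the logarithm -/

section LogarithmTrace

/-- A concave function lies below its tangents: the tangent to `x ↦ log (1 + x)` at `r`. -/
theorem log_one_add_le_tangent {x r : ℝ} (hx : 0 ≤ x) (hr : 0 ≤ r) :
    Real.log (1 + x) ≤ Real.log (1 + r) + (1 + r)⁻¹ * (x - r) := by
  have h := Real.log_le_sub_one_of_pos (x := (1 + x) / (1 + r)) (by positivity)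
  rw [Real.log_div (by positivity) (by positivity)] at h
  have : (1 + x) / (1 + r) - 1 = (1 + r)⁻¹ * (x - r) := by
    field_simp
    ring
  linarith

theorem deriv_lnOneAdd {z : ℂ} (hz : 1 + z ∈ Complex.slitPlane) :
    deriv lnOneAdd z = (1 + z)⁻¹ := by
  have h := (((hasDerivAt_id z).const_add 1).clog hz).deriv
  rwa [one_div] at h

variable {H : Type*} [NormedAddCommGroup H] [InnerProductSpace ℂ H] [CompleteSpace H]
  {S T : H →L[ℂ] H}

theorem continuousOn_log_one_add (hT : 0 ≤ T) :
    ContinuousOn (fun x : ℝ => Real.log (1 + x)) (spectrum ℝ T) := by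
  refine ContinuousOn.log (by fun_prop) fun x hx => ?_
  have := spectrum_nonneg_of_nonneg hT hx
  positivity

theorem continuousOn_one_add_inv (hT : 0 ≤ T) :
    ContinuousOn (fun x : ℝ => (1 + x)⁻¹) (spectrum ℝ T) := by
  refine ContinuousOn.inv₀ (by fun_prop) fun x hx => ?_
  have := spectrum_nonneg_of_nonneg hT hx
  positivity

theorem cfc_lnOneAdd (hT : 0 ≤ T) :
    cfc lnOneAdd T = cfc (fun x : ℝ => Real.log (1 + x)) T := by
  have h : ∀ z ∈ spectrum ℂ T, lnOneAdd z = (Real.log (1 + z.re) : ℂ) := by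
    intro z hz
    have hz0 := spectrum_nonneg_of_nonneg hT hz
    have hre := Complex.eq_re_of_ofReal_le (r := 0) (by simpa using hz0)
    have h0 := (Complex.le_def.mp hz0).1
    rw [Complex.ofReal_log (by simp at h0; positivity), lnOneAdd]
    nth_rw 1 [hre]
    push_cast; rfl
  rw [cfc_congr (g := fun z : ℂ => (Real.log (1 + z.re) : ℂ)) h,
    cfc_complex_eq_real T (fun z _ => Complex.conj_ofReal _) (IsSelfAdjoint.of_nonneg hT)]
  rfl

theorem cfc_deriv_lnOneAdd (hT : 0 ≤ T) :
    cfc (deriv lnOneAdd) T = cfc (fun x : ℝ => (1 + x)⁻¹) T := by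
  have h : ∀ z ∈ spectrum ℂ T, deriv lnOneAdd z = ((1 + z.re)⁻¹ : ℝ) := by
    intro z hz
    have hz0 := spectrum_nonneg_of_nonneg hT hz
    have hre := Complex.eq_re_of_ofReal_le (r := 0) (by simpa using hz0)
    have h0 := (Complex.le_def.mp hz0).1
    simp only [Complex.zero_re] at h0
    rw [deriv_lnOneAdd (Or.inl (by simp; positivity))]
    nth_rw 1 [hre]
    push_cast; rfl
  rw [cfc_congr (g := fun z : ℂ => (((1 + z.re)⁻¹ : ℝ) : ℂ)) h,
    cfc_complex_eq_real T (fun z _ => Complex.conj_ofReal _) (IsSelfAdjoint.of_nonneg hT)]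
  rfl

theorem cfc_lnOneAdd_nonneg (hT : 0 ≤ T) : 0 ≤ cfc lnOneAdd T := by
  rw [cfc_lnOneAdd hT]
  refine cfc_nonneg fun x hx => Real.log_nonneg ?_
  have := spectrum_nonneg_of_nonneg hT hx
  linarith

/-- The tangent line inequality at `r`, carried over to operators by the functional calculus. -/
theorem cfc_lnOneAdd_le_tangent (hT : 0 ≤ T) {r : ℝ} (hr : 0 ≤ r) :
    cfc lnOneAdd T ≤ algebraMap ℝ (H →L[ℂ] H) (Real.log (1 + r))
      + (1 + r)⁻¹ • (T - algebraMap ℝ (H →L[ℂ] H) r) := by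
  have hsa : IsSelfAdjoint T := IsSelfAdjoint.of_nonneg hT
  have h : cfc (fun x : ℝ => Real.log (1 + r) + (1 + r)⁻¹ * (x - r)) T
      = algebraMap ℝ (H →L[ℂ] H) (Real.log (1 + r))
        + (1 + r)⁻¹ • (T - algebraMap ℝ (H →L[ℂ] H) r) := by
    rw [cfc_const_add _ _ T, cfc_const_mul _ _ T, cfc_sub _ _ T, cfc_id' ℝ T, cfc_const r T]
  rw [cfc_lnOneAdd hT, ← h]
  exact cfc_mono (fun x hx => log_one_add_le_tangent (spectrum_nonneg_of_nonneg hT hx) hr)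
    (continuousOn_log_one_add hT) (by fun_prop)

/-- The tangent at `0` gives `0 ≤ log (1 + T) ≤ T`. -/
theorem IsTraceClass.cfc_lnOneAdd (hT : 0 ≤ T) (htc : IsTraceClass T) :
    IsTraceClass (cfc lnOneAdd T) := by
  refine htc.of_nonneg_of_le (cfc_lnOneAdd_nonneg hT) ?_
  simpa using cfc_lnOneAdd_le_tangent hT le_rfl

/-- On the spectrum of `T ≥ 0` the derivative is `(1 + x)⁻¹ ∈ (0, 1]`. -/
theorem cfc_deriv_lnOneAdd_contraction (hT : 0 ≤ T) :
    star (cfc (deriv lnOneAdd) T) * cfc (deriv lnOneAdd) T ≤ 1 := by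
  have hc := continuousOn_one_add_inv hT
  rw [cfc_deriv_lnOneAdd hT, ← cfc_star, ← cfc_mul _ _ T (by simpa using hc) hc]
  refine cfc_le_one _ T fun x hx => ?_
  have := spectrum_nonneg_of_nonneg hT hx
  simp only [star_trivial]
  exact mul_le_one₀ (inv_le_one_of_one_le₀ (by linarith)) (by positivity)
    (inv_le_one_of_one_le₀ (by linarith))

theorem inner_cfc_deriv_lnOneAdd_mul (hS : 0 ≤ S) (A : H →L[ℂ] H) {r : ℝ} {v : H}
    (hv : S v = (r : ℂ) • v) :
    inner ℂ v ((cfc (deriv lnOneAdd) S * A) v) = ((1 + r)⁻¹ : ℝ) * inner ℂ v (A v) := by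
  rw [cfc_deriv_lnOneAdd hS, mul_apply_eq_comp, ← adjoint_inner_left,
    ← star_eq_adjoint, (cfc_predicate _ S : IsSelfAdjoint _).star_eq,
    cfc_apply_eigenvector (IsSelfAdjoint.of_nonneg hS) hv (continuousOn_one_add_inv hS),
    inner_smul_left, Complex.conj_ofReal]

/-- The trace inequality on one diagonal term: at an eigenvector of `S` for the eigenvalue `r`, the
tangent line bound for `T` taken at the point `r` involves exactly `F(S)` and `F'(S)`. -/
theorem inner_cfc_lnOneAdd_le (hS : 0 ≤ S) (hT : 0 ≤ T) {r : ℝ} (hr : 0 ≤ r) {v : H}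
    (hv : S v = (r : ℂ) • v) :
    inner ℂ v (cfc lnOneAdd T v) ≤ inner ℂ v (cfc lnOneAdd S v)
      + inner ℂ v ((cfc (deriv lnOneAdd) S * (T - S)) v) := by
  refine (inner_apply_mono (cfc_lnOneAdd_le_tangent hT hr) v).trans_eq ?_
  rw [inner_cfc_deriv_lnOneAdd_mul hS _ hv, cfc_lnOneAdd hS,
    cfc_apply_eigenvector (IsSelfAdjoint.of_nonneg hS) hv (continuousOn_log_one_add hS),
    sub_apply, hv]
  simp only [Algebra.algebraMap_eq_smul_one, add_apply, smul_apply, sub_apply, one_apply_eq_self,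
    inner_add_right, ← Complex.coe_smul, inner_smul_right]

theorem nonneg_of_eigenvector (hS : 0 ≤ S) {r : ℝ} {v : H} (hv : S v = (r : ℂ) • v) (hv0 : v ≠ 0) :
    0 ≤ r := spectrum_nonneg_of_nonneg hS (mem_spectrum_of_eigenvector hv hv0)

/-- Klein's inequality for the concave function `x ↦ log (1 + x)`. -/
theorem opTrace_cfc_lnOneAdd_le (hS : 0 ≤ S) (hT : 0 ≤ T) (hSc : IsTraceClass S)
    (hTc : IsTraceClass T) :
    opTrace (cfc lnOneAdd T) ≤
      opTrace (cfc lnOneAdd S) + opTrace (cfc (deriv lnOneAdd) S * (T - S)) := by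
  obtain ⟨ι, b, r, hb⟩ := exists_hilbertBasis_eigenvectors (IsSelfAdjoint.of_nonneg hS)
    (hSc.isCompactOperator hS)
  exact hasSum_le
    (fun i => inner_cfc_lnOneAdd_le hS hT
      (nonneg_of_eigenvector hS (hb i) (b.orthonormal.ne_zero i)) (hb i))
    (hasSum_opTrace (cfc_lnOneAdd_nonneg hT) (hTc.cfc_lnOneAdd hT) b)
    ((hasSum_opTrace (cfc_lnOneAdd_nonneg hS) (hSc.cfc_lnOneAdd hS) b).add
      (hasSum_opTrace_mul_sub hS hT hSc hTc _ b))

/-- In an eigenbasis of `S` the diagonal terms are `(1 + rᵢ)⁻¹ ⟨eᵢ, (T - S) eᵢ⟩ ≤ ⟨eᵢ, |T - S| eᵢ⟩`. -/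
theorem opTrace_cfc_deriv_mul_sub_le (hS : 0 ≤ S) (hT : 0 ≤ T) (hSc : IsTraceClass S)
    (hTc : IsTraceClass T) :
    opTrace (cfc (deriv lnOneAdd) S * (T - S)) ≤ (traceNorm (T - S) : ℂ) := by
  obtain ⟨ι, b, r, hb⟩ := exists_hilbertBasis_eigenvectors (IsSelfAdjoint.of_nonneg hS)
    (hSc.isCompactOperator hS)
  refine hasSum_le (fun i => ?_) (hasSum_opTrace_mul_sub hS hT hSc hTc _ b)
    (hasSum_traceNorm (hSc.sub hS hT hTc) b)
  have hr := nonneg_of_eigenvector hS (hb i) (b.orthonormal.ne_zero i)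
  have hsa : IsSelfAdjoint (T - S) :=
    (IsSelfAdjoint.of_nonneg hT).sub (IsSelfAdjoint.of_nonneg hS)
  have hle : T - S ≤ CFC.abs (T - S) := by
    rw [← sub_nonneg, CFC.abs_sub_self (T - S) hsa]
    exact nsmul_nonneg (CFC.negPart_nonneg _) 2
  rw [inner_cfc_deriv_lnOneAdd_mul hS _ (hb i)]
  have h0 : (0 : ℂ) ≤ ((1 + r i)⁻¹ : ℝ) := by
    rw [Complex.zero_le_real]; positivity
  have h1 : (((1 + r i)⁻¹ : ℝ) : ℂ) ≤ 1 := by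
    exact_mod_cast inv_le_one_of_one_le₀ (by linarith : 1 ≤ 1 + r i)
  exact (mul_le_mul_of_nonneg_left (inner_apply_mono hle (b i)) h0).trans
    (mul_le_of_le_one_left (inner_apply_nonneg (CFC.abs_nonneg (T - S)) (b i)) h1)

theorem opTrace_im_eq_zero {T : H →L[ℂ] H} (hT : 0 ≤ T) : (opTrace T).im = 0 :=
  (Complex.le_def.mp (tsum_nonneg fun i => inner_apply_nonneg hT (chosenBasis H i))).2.symm

theorem traceNorm_sub_comm (S T : H →L[ℂ] H) : traceNorm (S - T) = traceNorm (T - S) := by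
  rw [traceNorm, ← neg_sub T S, CFC.abs_neg]
  rfl

end LogarithmTrace

/-- In the last conjunct `≤` is the order of `ℂ`: the difference of the two sides is real and
non-negative. -/
theorem lemma4 {H : Type*} [NormedAddCommGroup H] [InnerProductSpace ℂ H] [CompleteSpace H]
    [TopologicalSpace.SeparableSpace H]
    (T₁ T₂ : H →L[ℂ] H)
    (hpos₁ : T₁.IsPositive) (hpos₂ : T₂.IsPositive)
    (htc₁ : IsTraceClass T₁) (htc₂ : IsTraceClass T₂) :
    IsTraceClass (cfc lnOneAdd T₁) ∧
    IsTraceClass (cfc lnOneAdd T₂) ∧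
    IsTraceClass (T₂ - T₁) ∧
    IsTraceClass (cfc (deriv lnOneAdd) T₁ * (T₂ - T₁)) ∧
    (opTrace (cfc lnOneAdd T₁)).im = 0 ∧
    (opTrace (cfc lnOneAdd T₂)).im = 0 ∧
    ‖opTrace (cfc lnOneAdd T₂) - opTrace (cfc lnOneAdd T₁)‖ ≤ traceNorm (T₂ - T₁) ∧
    opTrace (cfc lnOneAdd T₂) ≤
      opTrace (cfc lnOneAdd T₁) + opTrace (cfc (deriv lnOneAdd) T₁ * (T₂ - T₁)) := by

  have h₁ : 0 ≤ T₁ := (nonneg_iff_isPositive T₁).mpr hpos₁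
  have h₂ : 0 ≤ T₂ := (nonneg_iff_isPositive T₂).mpr hpos₂
  have hsub := htc₁.sub h₁ h₂ htc₂
  have him₁ := opTrace_im_eq_zero (cfc_lnOneAdd_nonneg h₁)
  have him₂ := opTrace_im_eq_zero (cfc_lnOneAdd_nonneg h₂)
  have hle₁₂ := opTrace_cfc_lnOneAdd_le h₁ h₂ htc₁ htc₂
  refine ⟨htc₁.cfc_lnOneAdd h₁, htc₂.cfc_lnOneAdd h₂, hsub,
    hsub.mul_left_of_contraction (cfc_deriv_lnOneAdd_contraction h₁), him₁, him₂, ?_, hle₁₂⟩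
  -- Both one-sided bounds come from the trace inequality, the lower one with `T₁` and `T₂` exchanged.
  have hub := hle₁₂.trans (add_le_add_right (opTrace_cfc_deriv_mul_sub_le h₁ h₂ htc₁ htc₂) _)
  have hlb := (opTrace_cfc_lnOneAdd_le h₂ h₁ htc₂ htc₁).trans
    (add_le_add_right (opTrace_cfc_deriv_mul_sub_le h₂ h₁ htc₂ htc₁) _)
  rw [traceNorm_sub_comm T₁ T₂] at hlb
  have hub' := (Complex.le_def.mp hub).1
  have hlb' := (Complex.le_def.mp hlb).1
  rw [Complex.add_re, Complex.ofReal_re] at hub' hlb'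
  rw [← Complex.abs_re_eq_norm.mpr (by rw [Complex.sub_im, him₁, him₂, sub_zero]),
    Complex.sub_re, abs_le]
  constructor <;> linarith
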